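/- **Lemma (Soundness).** If the completion rules can be applied to an $\mathcal{ALCQPIH}_{R^+}$-concept $D$ in negation normal form so as to yield a complete and clash-free completion tree with respect to a role hierarchy $\mathcal R^+$, then $D$ has a tableau with respect to $\mathcal R^+$. This holds for every choice of the natural numbers $BAN_x$ (the border amount of neighbours of a node $x$ of a completion tree) used in the part rules. *Roles.* Let $\mathbf C_o,\mathbf R_o$ be nonempty sets of concept names and role names, $\mathbf R^+\subseteq\mathbf R_o$ the transitive role names, and $\mathbf Q_0\subseteq\mathbb Q\cap(0,1)$. Roles are $R$ and $R^-$ for $R\in\mathbf R_o$, with $\mathsf{Inv}(R)=R^-$, $\mathsf{Inv}(R^-)=R$; $\mathsf{Trans}(R)$ means that $R$ or $\mathsf{Inv}(R)$ is in $\mathbf R^+$. For a set $\mathcal R$ of role inclusions, $\sqsubseteq^+$ is the reflexive transitive closure of $\mathcal R\cup\{\mathsf{Inv}(R)\sqsubseteq\mathsf{Inv}(S): R\sqsubseteq S\in\mathcal R\}$. A role is simple if no $S\sqsubseteq^+R$ satisfies $\mathsf{Trans}(S)$. *Concepts.* They are built from concept names by $\neg C$, $C\sqcap D$, $C\sqcup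 D$, $\forall R.C$, $\exists R.C$, and, for simple $R$, $n\ge0$, $r\in\mathbf Q_0$, by ${\geqslant}nR.C$, ${\leqslant}nR.C$, $MrR.C$, $WrR.C$. In negation normal form (NNF) $\neg$ stands only before concept names; ${\sim}C$ is the NNF of $\neg C$, where ${\sim}MrR.C=WrR.{\sim}C$, ${\sim}WrR.C=MrR.{\sim}C$, and ${\sim}({\geqslant}0R.C)$ is the contradiction $C\sqcap{\sim}C$. $\mathbf R_D$ is the set of roles occurring in $D$ and their inverses, and $clos(D)$ is the smallest set containing $D$ and closed under sub-concepts and $\sim$. Let $clos^+(D)=clos(D)\cup\{\forall R.C:\ \forall S.C\in clos(D),\ \mathsf{Trans}(R),\ R\sqsubseteq^+S \text{ for some } S\}$. Below, $\boxtimes$ is any of $\exists,{\geqslant}n,{\leqslant}n,Mr,Wr$. *Tableaux.* A tableau for $D$ is a triple $(\mathbf S,\mathcal L,\mathcal E)$ with $\mathcal L:\mathbf S\to 2^{clos^+(D)}$, $\mathcal E:\mathbf R_D\to2^{\mathbf S\times\mathbf S}$, $D\in\mathcal L(s)$ for some $s$, and all sets $R^T(s)=\{t:\langle s,t\rangle\in\mathcal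 E(R)\}$ finite, such that for all $s,t\in\mathbf S$, $R,S\in\mathbf R_D$, with $R^T(s,C)=\{t\in R^T(s):C\in\mathcal L(t)\}$: 1. if $C\in\mathcal L(s)$ then $\neg C\notin\mathcal L(s)$; 2. if $C_1\sqcap C_2\in\mathcal L(s)$ then $C_1,C_2\in\mathcal L(s)$; 3. if $C_1\sqcup C_2\in\mathcal L(s)$ then $C_1\in\mathcal L(s)$ or $C_2\in\mathcal L(s)$; 4. if $\forall R.C\in\mathcal L(s)$ and $\langle s,t\rangle\in\mathcal E(R)$ then $C\in\mathcal L(t)$; 5. if $\exists R.C\in\mathcal L(s)$ then $\langle s,t\rangle\in\mathcal E(R)$ and $C\in\mathcal L(t)$ for some $t$; 6. if $\forall S.C\in\mathcal L(s)$, $\langle s,t\rangle\in\mathcal E(R)$, $R\sqsubseteq^+S$ and $\mathsf{Trans}(R)$, then $\forall R.C\in\mathcal L(t)$; 7. $\langle s,t\rangle\in\mathcal E(R)$ iff $\langle t,s\rangle\in\mathcal E(\mathsf{Inv}(R))$; 8. if $\langle s,t\rangle\in\mathcal E(R)$ and $R\sqsubseteq^+S$ then $\langle s,t\rangle\in\mathcal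 E(S)$; 9. if ${\leqslant}nR.C\in\mathcal L(s)$ then $\sharp R^T(s,C)\le n$; 10. if ${\geqslant}nR.C\in\mathcal L(s)$ then $\sharp R^T(s,C)\ge n$; 11. if $MrR.C\in\mathcal L(s)$ then $\sharp R^T(s,C)>r\cdot\sharp R^T(s)$; 12. if $WrR.C\in\mathcal L(s)$ then $\sharp R^T(s,{\sim}C)\le r\cdot\sharp R^T(s)$; 13. if $\boxtimes R.C\in\mathcal L(s)$ and $\langle s,t\rangle\in\mathcal E(R)$ then $C\in\mathcal L(t)$ or ${\sim}C\in\mathcal L(t)$. *Completion trees.* A completion tree is a finite rooted tree $\mathbf T$ with each node $x$ labelled by a set $\mathcal L(x)$ of concepts and each edge by a set $\mathcal L(\langle x,y\rangle)$ of roles. The initial tree is a single root labelled $\{D\}$. A successor $y$ of $x$ is an $R$-successor if some $S\in\mathcal L(\langle x,y\rangle)$ has $S\sqsubseteq^+R$; $y$ is an $R$-neighbour of $x$ if $y$ is an $R$-successor of $x$ or $x$ is an $\mathsf{Inv}(R)$-successor of $y$; $R^{\mathbf T}(x)$ is the set of $R$-neighbours of $x$ and $R^{\mathbf T}(x,C)$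 the set of those with $C$ in their label. If $z$ is the predecessor of $x$, then $\mathcal L(\langle x,z\rangle)$ means $\{\mathsf{Inv}(S):S\in\mathcal L(\langle z,x\rangle)\}$. *Blocking.* A node $x$ is directly blocked (by $y$) if none of its ancestors is blocked and it has ancestors $x',y,y'$ such that $x$ is a successor of $x'$, $y$ a successor of $y'$, $\mathcal L(x)=\mathcal L(y)$, $\mathcal L(x')=\mathcal L(y')$ and $\mathcal L(\langle x',x\rangle)=\mathcal L(\langle y',y\rangle)$. It is indirectly blocked if its predecessor is blocked or the edge leading to it has the label $\emptyset$. Blocked means directly or indirectly blocked. *Non-generating rules*, for a node $x$ that is not indirectly blocked: - $\sqcap$: if $C_1\sqcap C_2\in\mathcal L(x)$ and $\{C_1,C_2\}\not\subseteq\mathcal L(x)$, add $C_1,C_2$ to $\mathcal L(x)$. - $\sqcup$: if $C_1\sqcup C_2\in\mathcal L(x)$ and $\{C_1,C_2\}\cap\mathcal L(x)=\emptyset$, add $C_1$ or $C_2$ to $\mathcal L(x)$. - $\forall$: if $\forall R.C\in\mathcal L(x)$ and $y$ is an $R$-neighbour of $x$ with $C\notin\mathcal L(y)$, add $C$ to $\mathcal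 L(y)$. - $\forall_+$: if $\forall S.C\in\mathcal L(x)$, $\mathsf{Trans}(R)$, $R\sqsubseteq^+S$ and $y$ is an $R$-neighbour of $x$ with $\forall R.C\notin\mathcal L(y)$, add $\forall R.C$ to $\mathcal L(y)$. - choose: if $\boxtimes R.C\in\mathcal L(x)$ and $y$ is an $R$-neighbour of $x$ with $\{C,{\sim}C\}\cap\mathcal L(y)=\emptyset$, add $C$ or ${\sim}C$ to $\mathcal L(y)$. - $\leqslant$: if ${\leqslant}nR.C\in\mathcal L(x)$, $\sharp R^{\mathbf T}(x,C)>n$, and $y\ne z$ are in $R^{\mathbf T}(x,C)$ with $\mathcal L(\langle x,y\rangle)\cap\mathcal L(\langle x,z\rangle)=\emptyset$ and $y$ not the predecessor of $x$, then add $\mathcal L(y)$ to $\mathcal L(z)$; add $\{\mathsf{Inv}(S):S\in\mathcal L(\langle x,y\rangle)\}$ to $\mathcal L(\langle z,x\rangle)$ if $z$ is the predecessor of $x$, and add $\mathcal L(\langle x,y\rangle)$ to $\mathcal L(\langle x,z\rangle)$ otherwise; and set $\mathcal L(\langle x,y\rangle)=\emptyset$. *Generating rules*, for a node $x$ that is not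 blocked; each creates a new successor $y$ of $x$ with $\mathcal L(\langle x,y\rangle)=\{R\}$ and $\mathcal L(y)=\{C\}$: - $\exists$: if $\exists R.C\in\mathcal L(x)$ and $R^{\mathbf T}(x,C)=\emptyset$. - $\geqslant$: if ${\geqslant}nR.C\in\mathcal L(x)$ and $\sharp R^{\mathbf T}(x,C)<n$. - $M$: if $MrR.C\in\mathcal L(x)$, $\sharp R^{\mathbf T}(x,C)\le r\cdot\sharp R^{\mathbf T}(x)$ and $\sharp R^{\mathbf T}(x)<BAN_x$. - $W$: if $WrR.C\in\mathcal L(x)$, $\sharp R^{\mathbf T}(x,{\sim}C)>r\cdot\sharp R^{\mathbf T}(x)$ and $\sharp R^{\mathbf T}(x)<BAN_x$. Starting from the initial tree, the rules are applied one at a time in any order and with any of the choices allowed above, but a generating rule only when no non-generating rule is applicable. *Clashes.* $\mathbf T$ contains a clash if for some node $x$: (CL1) $\{C,\neg C\}\subseteq\mathcal L(x)$; (CL2) ${\leqslant}nR.C\in\mathcal L(x)$ and $\sharp R^{\mathbf T}(x,C)>n$; (CL3) $MrR.C\in\mathcal L(x)$ and $\sharp R^{\mathbf T}(x,C)\le r\cdot\sharp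 R^{\mathbf T}(x)$; or (CL4) $WrR.C\in\mathcal L(x)$ and $\sharp R^{\mathbf T}(x,{\sim}C)>r\cdot\sharp R^{\mathbf T}(x)$. Otherwise it is clash-free. $\mathbf T$ is complete if no rule is applicable or some node has a clash CL1 or CL2. -/

import Mathlib

namespace ALCQPIH

/-! ### Roles and role hierarchies -/

/-- Roles over the role names `NR`: a role name or the inverse of a role name. -/
inductive Role (NR : Type*) where
  | name : NR → Role NR
  | inverse : NR → Role NR

/-- The function `Inv` on roles. -/
def Role.inv {NR : Type*} : Role NR → Role NR
  | .name a => .inverse a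
  | .inverse a => .name a

/-- The role name underlying a role. -/
def Role.base {NR : Type*} : Role NR → NR
  | .name a => a
  | .inverse a => a

/-- The transitive role names together with a set of role inclusion axioms
(`(R, S) ∈ incl` stands for `R ⊑ S`). -/
structure RBox (NR : Type*) where
  transNames : Set NR
  incl : Set (Role NR × Role NR)

namespace RBox

variable {NR : Type*}

/-- One inclusion of the role hierarchy: `R ⊑ S` is given, or it is
`Inv(R') ⊑ Inv(S')` for a given `R' ⊑ S'`. -/
def Base (H : RBox NR) (R S : Role NR) : Prop :=
  (R, S) ∈ H.incl ∨ ∃ R' S' : Role NR, (R', S') ∈ H.incl ∧ R = R'.inv ∧ S = S'.inv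

/-- `R ⊑⁺ S`: the reflexive and transitive closure. -/
def Sub (H : RBox NR) (R S : Role NR) : Prop :=
  Relation.ReflTransGen H.Base R S

/-- `Trans(R)`: `R` or `Inv(R)` is a transitive role name. -/
def Trans (H : RBox NR) (R : Role NR) : Prop :=
  R.base ∈ H.transNames

/-- A role is simple if neither it nor any of its sub-roles is transitive. -/
def Simple (H : RBox NR) (R : Role NR) : Prop :=
  ∀ S : Role NR, H.Sub S R → ¬ H.Trans S

end RBox

/-! ### Concepts -/

/-- Concept expressions over the concept names `NC` and role names `NR`. -/
inductive Concept (NC NR : Type*) where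
  | atom : NC → Concept NC NR
  | neg : Concept NC NR → Concept NC NR
  | and : Concept NC NR → Concept NC NR → Concept NC NR
  | or : Concept NC NR → Concept NC NR → Concept NC NR
  | all : Role NR → Concept NC NR → Concept NC NR
  | ex : Role NR → Concept NC NR → Concept NC NR
  | atLeast : ℕ → Role NR → Concept NC NR → Concept NC NR
  | atMost : ℕ → Role NR → Concept NC NR → Concept NC NR
  /-- `M r R. C` -/
  | more : ℚ → Role NR → Concept NC NR → Concept NC NR
  /-- `W r R. C` -/
  | weak : ℚ → Role NR → Concept NC NR → Concept NC NR

namespace Concept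

variable {NC NR : Type*}

/-- The syntactic side conditions on concepts: roles in number restrictions and in part
restrictions are simple, and the indices of part restrictions belong to `Q₀`. -/
def IsConcept (H : RBox NR) (Q₀ : Set ℚ) : Concept NC NR → Prop
  | .atom _ => True
  | .neg C => C.IsConcept H Q₀
  | .and C D => C.IsConcept H Q₀ ∧ D.IsConcept H Q₀
  | .or C D => C.IsConcept H Q₀ ∧ D.IsConcept H Q₀
  | .all _ C => C.IsConcept H Q₀
  | .ex _ C => C.IsConcept H Q₀
  | .atLeast _ R C => H.Simple R ∧ C.IsConcept H Q₀
  | .atMost _ R C => H.Simple R ∧ C.IsConcept H Q₀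
  | .more r R C => r ∈ Q₀ ∧ H.Simple R ∧ C.IsConcept H Q₀
  | .weak r R C => r ∈ Q₀ ∧ H.Simple R ∧ C.IsConcept H Q₀

/-- Negation normal form: negation only in front of concept names. -/
def IsNNF : Concept NC NR → Prop
  | .atom _ => True
  | .neg (.atom _) => True
  | .neg _ => False
  | .and C D => C.IsNNF ∧ D.IsNNF
  | .or C D => C.IsNNF ∧ D.IsNNF
  | .all _ C => C.IsNNF
  | .ex _ C => C.IsNNF
  | .atLeast _ _ C => C.IsNNF
  | .atMost _ _ C => C.IsNNF
  | .more _ _ C => C.IsNNF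
  | .weak _ _ C => C.IsNNF

mutual

/-- The negation normal form of `C`. -/
def nnf : Concept NC NR → Concept NC NR
  | .atom A => .atom A
  | .neg C => C.compl
  | .and C D => .and C.nnf D.nnf
  | .or C D => .or C.nnf D.nnf
  | .all R C => .all R C.nnf
  | .ex R C => .ex R C.nnf
  | .atLeast n R C => .atLeast n R C.nnf
  | .atMost n R C => .atMost n R C.nnf
  | .more r R C => .more r R C.nnf
  | .weak r R C => .weak r R C.nnf

/-- `∼ C`, the negation normal form of `¬ C`. The unsatisfiable `¬ ≥ 0 R. C` becomes the
contradiction `C ⊓ ∼ C`. -/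
def compl : Concept NC NR → Concept NC NR
  | .atom A => .neg (.atom A)
  | .neg C => C.nnf
  | .and C D => .or C.compl D.compl
  | .or C D => .and C.compl D.compl
  | .all R C => .ex R C.compl
  | .ex R C => .all R C.compl
  | .atLeast 0 _ C => .and C.nnf C.compl
  | .atLeast (n + 1) R C => .atMost n R C.nnf
  | .atMost n R C => .atLeast (n + 1) R C.nnf
  | .more r R C => .weak r R C.compl
  | .weak r R C => .more r R C.compl

end

/-- The immediate sub-concepts. -/
def children : Concept NC NR → Set (Concept NC NR)
  | .atom _ => ∅
  | .neg C => {C}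
  | .and C D => {C, D}
  | .or C D => {C, D}
  | .all _ C => {C}
  | .ex _ C => {C}
  | .atLeast _ _ C => {C}
  | .atMost _ _ C => {C}
  | .more _ _ C => {C}
  | .weak _ _ C => {C}

/-- The roles written in a concept. -/
def occ : Concept NC NR → Set (Role NR)
  | .atom _ => ∅
  | .neg C => C.occ
  | .and C D => C.occ ∪ D.occ
  | .or C D => C.occ ∪ D.occ
  | .all R C => {R} ∪ C.occ
  | .ex R C => {R} ∪ C.occ
  | .atLeast _ R C => {R} ∪ C.occ
  | .atMost _ R C => {R} ∪ C.occ
  | .more _ R C => {R} ∪ C.occ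
  | .weak _ R C => {R} ∪ C.occ

/-- The roles occurring in `D` and their inverses. -/
def roles (D : Concept NC NR) : Set (Role NR) :=
  {R | R ∈ D.occ ∨ R.inv ∈ D.occ}

/-- `E ∈ clos(D)`: the smallest set containing `D` and closed under sub-concepts and `∼`. -/
inductive Clos (D : Concept NC NR) : Concept NC NR → Prop
  | self : Clos D D
  | child {C E : Concept NC NR} : Clos D C → E ∈ C.children → Clos D E
  | compl {C : Concept NC NR} : Clos D C → Clos D C.compl

/-- The concepts allowed in labels: `clos(D)` together with the value restrictions `∀ R. C`
that transitive sub-roles `R` of `S` produce from some `∀ S. C` in `clos(D)`. -/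
def labels (H : RBox NR) (D : Concept NC NR) : Set (Concept NC NR) :=
  {E | D.Clos E ∨ ∃ (R S : Role NR) (C : Concept NC NR),
    E = .all R C ∧ D.Clos (.all S C) ∧ H.Trans R ∧ H.Sub R S}

/-- `E` has the form `⊠ R. C`, where `⊠` is one of `∃`, `≥ n`, `≤ n`, `M r`, `W r`. -/
inductive IsBox (R : Role NR) (C : Concept NC NR) : Concept NC NR → Prop
  | ex : IsBox R C (.ex R C)
  | atLeast (n : ℕ) : IsBox R C (.atLeast n R C)
  | atMost (n : ℕ) : IsBox R C (.atMost n R C)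
  | more (r : ℚ) : IsBox R C (.more r R C)
  | weak (r : ℚ) : IsBox R C (.weak r R C)

end Concept

/-! ### Tableaux -/

section Tableau

variable {NC NR : Type*}

/-- `(S, L, E)` is a tableau for `D` with respect to the role hierarchy of `H`. Only the values of
`E` at the roles in `D.roles` matter. -/
structure IsTableau (H : RBox NR) (D : Concept NC NR) (S : Type)
    (L : S → Set (Concept NC NR)) (E : Role NR → S → S → Prop) : Prop where
  label_subset : ∀ s, L s ⊆ D.labels H
  root : ∃ s, D ∈ L s
  /-- All neighbour sets are finite, so that their cardinalities are natural numbers. -/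
  finite : ∀ s, ∀ R ∈ D.roles, {t | E R s t}.Finite
  p1 : ∀ s C, C ∈ L s → Concept.neg C ∉ L s
  p2 : ∀ s C₁ C₂, Concept.and C₁ C₂ ∈ L s → C₁ ∈ L s ∧ C₂ ∈ L s
  p3 : ∀ s C₁ C₂, Concept.or C₁ C₂ ∈ L s → C₁ ∈ L s ∨ C₂ ∈ L s
  p4 : ∀ s t C, ∀ R ∈ D.roles, Concept.all R C ∈ L s → E R s t → C ∈ L t
  p5 : ∀ s C, ∀ R ∈ D.roles, Concept.ex R C ∈ L s → ∃ t, E R s t ∧ C ∈ L t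
  p6 : ∀ s t C, ∀ R ∈ D.roles, ∀ S ∈ D.roles, Concept.all S C ∈ L s → E R s t →
    H.Sub R S → H.Trans R → Concept.all R C ∈ L t
  p7 : ∀ s t, ∀ R ∈ D.roles, E R s t ↔ E R.inv t s
  p8 : ∀ s t, ∀ R ∈ D.roles, ∀ S ∈ D.roles, E R s t → H.Sub R S → E S s t
  p9 : ∀ s C n, ∀ R ∈ D.roles, Concept.atMost n R C ∈ L s →
    {t | E R s t ∧ C ∈ L t}.ncard ≤ n
  p10 : ∀ s C n, ∀ R ∈ D.roles, Concept.atLeast n R C ∈ L s →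
    n ≤ {t | E R s t ∧ C ∈ L t}.ncard
  p11 : ∀ s C r, ∀ R ∈ D.roles, Concept.more r R C ∈ L s →
    r * ({t | E R s t}.ncard : ℚ) < ({t | E R s t ∧ C ∈ L t}.ncard : ℚ)
  p12 : ∀ s C r, ∀ R ∈ D.roles, Concept.weak r R C ∈ L s →
    ({t | E R s t ∧ C.compl ∈ L t}.ncard : ℚ) ≤ r * ({t | E R s t}.ncard : ℚ)
  p13 : ∀ s t C F, ∀ R ∈ D.roles, Concept.IsBox R C F → F ∈ L s → E R s t →
    C ∈ L t ∨ C.compl ∈ L t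

/-- `D` has a tableau with respect to the role hierarchy of `H`. -/
def HasTableau (H : RBox NR) (D : Concept NC NR) : Prop :=
  ∃ (S : Type) (L : S → Set (Concept NC NR)) (E : Role NR → S → S → Prop), IsTableau H D S L E

end Tableau

/-! ### Completion trees -/

/-- Nodes are addresses: `[]` is the root, and the successors of `x` are the nodes `k :: x`. -/
abbrev Node : Type := List ℕ

/-- `y` is a successor of `x` (and `x` the predecessor of `y`). -/
def IsSucc (x y : Node) : Prop := ∃ k : ℕ, y = k :: x

/-- `y` is a (proper) ancestor of `x`. -/
def IsAncestor (y x : Node) : Prop := y <:+ x ∧ y ≠ x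

/-- A finite tree whose nodes are labelled with sets of concepts and whose edges are labelled with
sets of roles; `edge y` is the label of the edge from the predecessor of `y` to `y`. -/
structure CTree (NC NR : Type*) where
  nodes : Finset Node
  label : Node → Set (Concept NC NR)
  edge : Node → Set (Role NR)

namespace CTree

variable {NC NR : Type*}

/-- The single root with label `{D}`. -/
def init (D : Concept NC NR) : CTree NC NR where
  nodes := {[]}
  label := Function.update (fun _ => ∅) [] {D}
  edge := fun _ => ∅

/-- `y` is an `R`-successor of `x`. -/
def RSucc (H : RBox NR) (T : CTree NC NR) (R : Role NR) (x y : Node) : Prop :=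
  x ∈ T.nodes ∧ y ∈ T.nodes ∧ IsSucc x y ∧ ∃ S ∈ T.edge y, H.Sub S R

/-- `y` is an `R`-neighbour of `x`. -/
def RNbr (H : RBox NR) (T : CTree NC NR) (R : Role NR) (x y : Node) : Prop :=
  T.RSucc H R x y ∨ T.RSucc H R.inv y x

/-- The number of `R`-neighbours of `x`. -/
noncomputable def numNbr (H : RBox NR) (T : CTree NC NR) (R : Role NR) (x : Node) : ℕ :=
  {y | T.RNbr H R x y}.ncard

/-- The number of `R`-neighbours of `x` labelled with `C`. -/
noncomputable def numNbrWith (H : RBox NR) (T : CTree NC NR) (R : Role NR) (x : Node)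
    (C : Concept NC NR) : ℕ :=
  {y | T.RNbr H R x y ∧ C ∈ T.label y}.ncard

/-- The label of the edge between `x` and `y` read from `x` to `y`: an edge from `y` to its
successor `x` is read with inverse roles. -/
def between (T : CTree NC NR) (x y : Node) : Set (Role NR) :=
  {S | (IsSucc x y ∧ S ∈ T.edge y) ∨ (IsSucc y x ∧ S.inv ∈ T.edge x)}

/-! #### Pair-wise blocking -/

/-- `y` and its predecessor `y'` look like `x` and its predecessor `x'`, where `x'`, `y` and `y'`
are ancestors of `x`. -/
def Matches (T : CTree NC NR) (y x : Node) : Prop :=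
  ∃ x' y' : Node, IsAncestor x' x ∧ IsAncestor y x ∧ IsAncestor y' x ∧
    IsSucc x' x ∧ IsSucc y' y ∧
    T.label x = T.label y ∧ T.label x' = T.label y' ∧ T.edge x = T.edge y

/-- A node is blocked if its predecessor is blocked, or the edge leading to it has the empty label
(it has been merged into another node), or it matches one of its ancestors. -/
def Blocked (T : CTree NC NR) : Node → Prop
  | [] => False
  | k :: p => T.Blocked p ∨ T.edge (k :: p) = ∅ ∨ ∃ y, T.Matches y (k :: p)

/-- `y` blocks `x`. -/
def Blocks (T : CTree NC NR) (y x : Node) : Prop :=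
  (∀ z, IsAncestor z x → ¬ T.Blocked z) ∧ T.Matches y x

/-- `x` is directly blocked. -/
def DirectlyBlocked (T : CTree NC NR) (x : Node) : Prop :=
  ∃ y, T.Blocks y x

/-- `x` is indirectly blocked: its predecessor is blocked, or it has been merged. -/
def IndirectlyBlocked (T : CTree NC NR) : Node → Prop
  | [] => False
  | k :: p => T.Blocked p ∨ T.edge (k :: p) = ∅

theorem blocked_of_suffix (T : CTree NC NR) {z : Node} (hz : T.Blocked z) :
    ∀ x : Node, z <:+ x → T.Blocked x
  | [], h => by
    have : z = [] := List.suffix_nil.mp h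
    rwa [← this]
  | k :: p, h => by
    rcases List.suffix_cons_iff.mp h with h | h
    · rwa [← h]
    · exact Or.inl (T.blocked_of_suffix hz p h)

/-- Blocked means directly or indirectly blocked. -/
theorem blocked_iff (T : CTree NC NR) (x : Node) :
    T.Blocked x ↔ T.DirectlyBlocked x ∨ T.IndirectlyBlocked x := by
  cases x with
  | nil =>
    refine ⟨fun h => h.elim, ?_⟩
    rintro (⟨y, -, x', y', -, -, -, ⟨k, hk⟩, -⟩ | h)
    · exact absurd hk (by simp)
    · exact h.elim
  | cons k p =>
    constructor
    · rintro (h | h | ⟨y, hy⟩)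
      · exact Or.inr (Or.inl h)
      · exact Or.inr (Or.inr h)
      · by_cases hp : T.Blocked p
        · exact Or.inr (Or.inl hp)
        · refine Or.inl ⟨y, fun z hz hb => hp ?_, hy⟩
          rcases List.suffix_cons_iff.mp hz.1 with h | h
          · exact absurd h hz.2
          · exact T.blocked_of_suffix hb p h
    · rintro (⟨y, -, hy⟩ | h | h)
      · exact Or.inr (Or.inr ⟨y, hy⟩)
      · exact Or.inl h
      · exact Or.inr (Or.inl h)

/-! #### Clashes -/

def Clash1 (T : CTree NC NR) : Prop :=
  ∃ x ∈ T.nodes, ∃ C, C ∈ T.label x ∧ Concept.neg C ∈ T.label x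

def Clash2 (H : RBox NR) (T : CTree NC NR) : Prop :=
  ∃ x ∈ T.nodes, ∃ n R C, Concept.atMost n R C ∈ T.label x ∧ n < T.numNbrWith H R x C

def Clash3 (H : RBox NR) (T : CTree NC NR) : Prop :=
  ∃ x ∈ T.nodes, ∃ r R C, Concept.more r R C ∈ T.label x ∧
    (T.numNbrWith H R x C : ℚ) ≤ r * (T.numNbr H R x : ℚ)

def Clash4 (H : RBox NR) (T : CTree NC NR) : Prop :=
  ∃ x ∈ T.nodes, ∃ r R C, Concept.weak r R C ∈ T.label x ∧
    r * (T.numNbr H R x : ℚ) < (T.numNbrWith H R x C.compl : ℚ)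

def ClashFree (H : RBox NR) (T : CTree NC NR) : Prop :=
  ¬ T.Clash1 ∧ ¬ T.Clash2 H ∧ ¬ T.Clash3 H ∧ ¬ T.Clash4 H

/-! #### Completion rules -/

/-- Add the concepts in `X` to the label of `y`. -/
def addLabel (T : CTree NC NR) (y : Node) (X : Set (Concept NC NR)) : CTree NC NR where
  nodes := T.nodes
  label := Function.update T.label y (T.label y ∪ X)
  edge := T.edge

/-- Create the node `y` with label `{C}`, the edge to it being labelled `{R}`. -/
def addNode (T : CTree NC NR) (y : Node) (R : Role NR) (C : Concept NC NR) : CTree NC NR where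
  nodes := insert y T.nodes
  label := Function.update T.label y {C}
  edge := Function.update T.edge y {R}

open Classical in
/-- Merge the successor `y` of `x` into the neighbour `z` of `x`. -/
noncomputable def merge (T : CTree NC NR) (x y z : Node) : CTree NC NR where
  nodes := T.nodes
  label := Function.update T.label z (T.label z ∪ T.label y)
  edge := Function.update
    (if IsSucc z x then Function.update T.edge x (T.edge x ∪ Role.inv '' T.edge y)
      else Function.update T.edge z (T.edge z ∪ T.edge y))
    y ∅

/-- The applications of the non-generating rules, with their results. -/
inductive NonGen (H : RBox NR) (T : CTree NC NR) : CTree NC NR → Prop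
  | and {x : Node} {C₁ C₂ : Concept NC NR} :
      x ∈ T.nodes → Concept.and C₁ C₂ ∈ T.label x → ¬ T.IndirectlyBlocked x →
      ¬ (C₁ ∈ T.label x ∧ C₂ ∈ T.label x) →
      NonGen H T (T.addLabel x {C₁, C₂})
  | or {x : Node} {C₁ C₂ E : Concept NC NR} :
      x ∈ T.nodes → Concept.or C₁ C₂ ∈ T.label x → ¬ T.IndirectlyBlocked x →
      C₁ ∉ T.label x → C₂ ∉ T.label x → (E = C₁ ∨ E = C₂) →
      NonGen H T (T.addLabel x {E})
  | all {x y : Node} {R : Role NR} {C : Concept NC NR} :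
      x ∈ T.nodes → Concept.all R C ∈ T.label x → ¬ T.IndirectlyBlocked x →
      T.RNbr H R x y → C ∉ T.label y →
      NonGen H T (T.addLabel y {C})
  | allPlus {x y : Node} {R S : Role NR} {C : Concept NC NR} :
      x ∈ T.nodes → Concept.all S C ∈ T.label x → ¬ T.IndirectlyBlocked x →
      H.Trans R → H.Sub R S →
      T.RNbr H R x y → Concept.all R C ∉ T.label y →
      NonGen H T (T.addLabel y {Concept.all R C})
  | choose {x y : Node} {R : Role NR} {C E F : Concept NC NR} :
      x ∈ T.nodes → Concept.IsBox R C F → F ∈ T.label x → ¬ T.IndirectlyBlocked x →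
      T.RNbr H R x y → C ∉ T.label y → C.compl ∉ T.label y → (E = C ∨ E = C.compl) →
      NonGen H T (T.addLabel y {E})
  | atMost {x y z : Node} {n : ℕ} {R : Role NR} {C : Concept NC NR} :
      x ∈ T.nodes → Concept.atMost n R C ∈ T.label x → ¬ T.IndirectlyBlocked x →
      n < T.numNbrWith H R x C →
      T.RNbr H R x y → T.RNbr H R x z → y ≠ z → C ∈ T.label y → C ∈ T.label z →
      T.between x y ∩ T.between x z = ∅ → ¬ IsSucc y x →
      NonGen H T (T.merge x y z)

/-- The applications of the generating rules, with their results. `ban T x` is the border amount of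
neighbours used for the node `x` of `T`. -/
inductive Gen (H : RBox NR) (ban : CTree NC NR → Node → ℕ) (T : CTree NC NR) : CTree NC NR → Prop
  | ex {x y : Node} {R : Role NR} {C : Concept NC NR} :
      x ∈ T.nodes → Concept.ex R C ∈ T.label x → ¬ T.Blocked x →
      (¬ ∃ z, T.RNbr H R x z ∧ C ∈ T.label z) →
      IsSucc x y → y ∉ T.nodes → Gen H ban T (T.addNode y R C)
  | atLeast {x y : Node} {n : ℕ} {R : Role NR} {C : Concept NC NR} :
      x ∈ T.nodes → Concept.atLeast n R C ∈ T.label x → ¬ T.Blocked x →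
      T.numNbrWith H R x C < n →
      IsSucc x y → y ∉ T.nodes → Gen H ban T (T.addNode y R C)
  | more {x y : Node} {r : ℚ} {R : Role NR} {C : Concept NC NR} :
      x ∈ T.nodes → Concept.more r R C ∈ T.label x → ¬ T.Blocked x →
      (T.numNbrWith H R x C : ℚ) ≤ r * (T.numNbr H R x : ℚ) →
      T.numNbr H R x < ban T x →
      IsSucc x y → y ∉ T.nodes → Gen H ban T (T.addNode y R C)
  | weak {x y : Node} {r : ℚ} {R : Role NR} {C : Concept NC NR} :
      x ∈ T.nodes → Concept.weak r R C ∈ T.label x → ¬ T.Blocked x →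
      r * (T.numNbr H R x : ℚ) < (T.numNbrWith H R x C.compl : ℚ) →
      T.numNbr H R x < ban T x →
      IsSucc x y → y ∉ T.nodes → Gen H ban T (T.addNode y R C)

/-- One rule application under the strategy that a generating rule is applied only if no
non-generating rule is applicable. -/
def Step (H : RBox NR) (ban : CTree NC NR → Node → ℕ) (T T' : CTree NC NR) : Prop :=
  T.NonGen H T' ∨ ((¬ ∃ T'', T.NonGen H T'') ∧ T.Gen H ban T')

/-- The completion rules, applied to `D`, can yield `T`. -/
def Yields (H : RBox NR) (ban : CTree NC NR → Node → ℕ) (D : Concept NC NR)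
    (T : CTree NC NR) : Prop :=
  Relation.ReflTransGen (Step H ban) (init D) T

/-- `T` is complete: no completion rule is applicable, or some node label contains a clash of the
first or of the second type. -/
def Complete (H : RBox NR) (ban : CTree NC NR → Node → ℕ) (T : CTree NC NR) : Prop :=
  ((¬ ∃ T', T.NonGen H T') ∧ (¬ ∃ T', T.Gen H ban T')) ∨ T.Clash1 ∨ T.Clash2 H

end CTree

end ALCQPIH

/-!
The tableau is the unravelling of the completion tree `T`: its elements are the paths that start at
the root and, on reaching a directly blocked node, continue with the successors of the node blocking
it. A path `s` thus stands for an unblocked node `s.node` with the same label, at which no rule is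
applicable. Pair-wise blocking compares the predecessors and the incoming edges as well, so the
neighbours of `s` correspond bijectively, with equal labels, to the neighbours of `s.node` in `T`.
All conditions on neighbours, the counting ones included, are therefore inherited from `T`. The
conditions for `≤ n`, `M r` and `W r` come from the absence of the clashes (CL2)–(CL4) rather than
from the rules, which is why every choice of the numbers `BAN_x` works.
-/

namespace ALCQPIH

variable {NC NR : Type*}

theorem Role.inv_inv (R : Role NR) : R.inv.inv = R := by
  cases R <;> rfl

namespace RBox

variable {H : RBox NR} {R S : Role NR}

theorem Base.inv (h : H.Base R S) : H.Base R.inv S.inv := by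
  rcases h with h | ⟨R', S', h, rfl, rfl⟩
  · exact Or.inr ⟨R, S, h, rfl, rfl⟩
  · rw [Role.inv_inv, Role.inv_inv]
    exact Or.inl h

theorem Sub.inv (h : H.Sub R S) : H.Sub R.inv S.inv :=
  h.lift Role.inv fun _ _ => Base.inv

end RBox

namespace Concept

variable {H : RBox NR} {D C F : Concept NC NR} {R S : Role NR}

theorem Clos.mem_labels (h : D.Clos C) : C ∈ D.labels H :=
  Or.inl h

theorem clos_of_mem_children (hF : F ∈ D.labels H) (hC : C ∈ F.children) : D.Clos C := by
  rcases hF with hF | ⟨R, S, E, rfl, hSE, -, -⟩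
  · exact hF.child hC
  · exact hSE.child hC

theorem all_mem_labels_of_sub (h : all S C ∈ D.labels H) (hR : H.Trans R) (hRS : H.Sub R S) :
    all R C ∈ D.labels H := by
  rcases h with h | ⟨_, S', _, ⟨⟩, h, -, hSS'⟩
  · exact Or.inr ⟨R, S, C, rfl, h, hR, hRS⟩
  · exact Or.inr ⟨R, S', C, rfl, h, hR, hRS.trans hSS'⟩

theorem IsBox.mem_children (h : IsBox R C F) : C ∈ F.children := by
  cases h <;> rfl

end Concept

theorem IsSucc.tail_eq {x y : Node} (h : IsSucc x y) : y.tail = x := by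
  obtain ⟨k, rfl⟩ := h
  rfl

theorem IsSucc.suffix {x y : Node} (h : IsSucc x y) : x <:+ y := by
  obtain ⟨k, rfl⟩ := h
  exact List.suffix_cons k x

theorem not_isSucc_nil (x : Node) : ¬ IsSucc x [] := by
  rintro ⟨k, hk⟩
  exact List.cons_ne_nil k x hk.symm

namespace CTree

variable {H : RBox NR} {D : Concept NC NR} {T T' : CTree NC NR} {x y : Node} {R S : Role NR}
  {C C₁ C₂ F : Concept NC NR}

/-! ### Invariants of the completion rules -/

/-- The nodes of `T` form a tree: they contain the root and all ancestors of their elements. -/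
structure IsTree (T : CTree NC NR) : Prop where
  root_mem : [] ∈ T.nodes
  mem_of_suffix : ∀ ⦃x y : Node⦄, x <:+ y → y ∈ T.nodes → x ∈ T.nodes

/-- The invariants of the completion rules applied to `D`: a tree whose root carries `D` and whose
labels stay within `clos⁺(D)`. Labels of addresses outside the tree are constrained too. -/
structure IsCompletionTree (H : RBox NR) (D : Concept NC NR) (T : CTree NC NR) : Prop
    extends IsTree T where
  root_label : D ∈ T.label []
  label_subset : ∀ x, T.label x ⊆ D.labels H

theorem isCompletionTree_init (H : RBox NR) (D : Concept NC NR) :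
    IsCompletionTree H D (init D) where
  root_mem := Finset.mem_singleton_self _
  mem_of_suffix x y hxy hy := by
    obtain rfl : y = [] := Finset.mem_singleton.mp hy
    exact Finset.mem_singleton.mpr (List.suffix_nil.mp hxy)
  root_label := by simp only [init, Function.update_self, Set.mem_singleton_iff]
  label_subset := update_le_iff.mpr
    ⟨Set.singleton_subset_iff.mpr Concept.Clos.self.mem_labels, fun _ _ => Set.empty_subset _⟩

namespace IsCompletionTree

theorem update_label (hT : T.IsCompletionTree H D) {X : Set (Concept NC NR)}
    (hX : X ⊆ D.labels H) (y : Node) (e : Node → Set (Role NR)) :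
    IsCompletionTree H D ⟨T.nodes, Function.update T.label y (T.label y ∪ X), e⟩ where
  toIsTree := ⟨hT.root_mem, hT.mem_of_suffix⟩
  root_label :=
    have hle : T.label ≤ Function.update T.label y (T.label y ∪ X) :=
      le_update_self_iff.mpr Set.subset_union_left
    hle [] hT.root_label
  label_subset := update_le_iff.mpr
    ⟨Set.union_subset (hT.label_subset y) hX, fun z _ => hT.label_subset z⟩

theorem addLabel_singleton (hT : T.IsCompletionTree H D) (hC : C ∈ D.labels H) (y : Node) :
    (T.addLabel y {C}).IsCompletionTree H D :=
  hT.update_label (Set.singleton_subset_iff.mpr hC) y T.edge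

theorem addNode (hT : T.IsCompletionTree H D) (hC : C ∈ D.labels H) (hx : x ∈ T.nodes)
    (hxy : IsSucc x y) (R : Role NR) : (T.addNode y R C).IsCompletionTree H D where
  root_mem := Finset.mem_insert_of_mem hT.root_mem
  mem_of_suffix u v huv hv := by
    obtain ⟨k, rfl⟩ := hxy
    rcases Finset.mem_insert.mp hv with rfl | hv
    · rcases List.suffix_cons_iff.mp huv with rfl | hux
      · exact hv
      · exact Finset.mem_insert_of_mem (hT.mem_of_suffix hux hx)
    · exact Finset.mem_insert_of_mem (hT.mem_of_suffix huv hv)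
  root_label := by
    have hy : [] ≠ y := fun h => not_isSucc_nil x (h ▸ hxy)
    simpa only [CTree.addNode, Function.update_of_ne hy] using hT.root_label
  label_subset := update_le_iff.mpr
    ⟨Set.singleton_subset_iff.mpr hC, fun z _ => hT.label_subset z⟩

theorem nonGen (hT : T.IsCompletionTree H D) (h : T.NonGen H T') : T'.IsCompletionTree H D := by
  have clos {x F C} (hF : F ∈ T.label x) (hC : C ∈ F.children) : D.Clos C :=
    Concept.clos_of_mem_children (hT.label_subset x hF) hC
  cases h with
  | and _ hF =>
    exact hT.update_label (fun _ hC => (clos hF hC).mem_labels) _ _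
  | or _ hF _ _ _ hE =>
    exact hT.addLabel_singleton (clos hF hE).mem_labels _
  | all _ hF =>
    exact hT.addLabel_singleton (clos hF rfl).mem_labels _
  | allPlus _ hF _ hR hRS =>
    exact hT.addLabel_singleton
      (Concept.all_mem_labels_of_sub (hT.label_subset _ hF) hR hRS) _
  | choose _ hbox hF _ _ _ _ hE =>
    have hC := clos hF hbox.mem_children
    rcases hE with rfl | rfl
    · exact hT.addLabel_singleton hC.mem_labels _
    · exact hT.addLabel_singleton hC.compl.mem_labels _
  | atMost => exact hT.update_label (hT.label_subset _) _ _

theorem gen {ban : CTree NC NR → Node → ℕ} (hT : T.IsCompletionTree H D) (h : T.Gen H ban T') :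
    T'.IsCompletionTree H D := by
  have addNode_child {x y F R C} (hx : x ∈ T.nodes) (hF : F ∈ T.label x) (hC : C ∈ F.children)
      (hxy : IsSucc x y) : (T.addNode y R C).IsCompletionTree H D :=
    hT.addNode (Concept.clos_of_mem_children (hT.label_subset x hF) hC).mem_labels hx hxy R
  cases h with
  | ex hx hF _ _ hxy _ => exact addNode_child hx hF rfl hxy
  | atLeast hx hF _ _ hxy _ => exact addNode_child hx hF rfl hxy
  | more hx hF _ _ _ hxy _ => exact addNode_child hx hF rfl hxy
  | weak hx hF _ _ _ hxy _ => exact addNode_child hx hF rfl hxy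

end IsCompletionTree

theorem Yields.isCompletionTree {ban : CTree NC NR → Node → ℕ} (h : Yields H ban D T) :
    T.IsCompletionTree H D := by
  induction h with
  | refl => exact isCompletionTree_init H D
  | tail _ hstep ih => exact hstep.elim ih.nonGen fun hgen => ih.gen hgen.2

/-! ### Nodes of complete and clash-free trees -/

theorem exists_isSucc_notMem_nodes (T : CTree NC NR) (x : Node) :
    ∃ y, IsSucc x y ∧ y ∉ T.nodes := by
  have hinj : Function.Injective (fun k : ℕ => k :: x) := fun _ _ h => (List.cons.inj h).1
  obtain ⟨_, ⟨k, rfl⟩, hk⟩ :=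
    (Set.infinite_range_of_injective hinj).exists_notMem_finset T.nodes
  exact ⟨k :: x, ⟨k, rfl⟩, hk⟩

theorem mem_label_of_and (hnon : ¬ ∃ T', T.NonGen H T') (hx : x ∈ T.nodes)
    (hb : ¬ T.IndirectlyBlocked x) (h : .and C₁ C₂ ∈ T.label x) :
    C₁ ∈ T.label x ∧ C₂ ∈ T.label x := by
  by_contra hn
  exact hnon ⟨_, .and hx h hb hn⟩

theorem mem_label_of_or (hnon : ¬ ∃ T', T.NonGen H T') (hx : x ∈ T.nodes)
    (hb : ¬ T.IndirectlyBlocked x) (h : .or C₁ C₂ ∈ T.label x) :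
    C₁ ∈ T.label x ∨ C₂ ∈ T.label x := by
  by_contra! hn
  exact hnon ⟨_, .or hx h hb hn.1 hn.2 (.inl rfl)⟩

theorem mem_label_of_all (hnon : ¬ ∃ T', T.NonGen H T') (hx : x ∈ T.nodes)
    (hb : ¬ T.IndirectlyBlocked x) (h : .all R C ∈ T.label x) (hxy : T.RNbr H R x y) :
    C ∈ T.label y := by
  by_contra hn
  exact hnon ⟨_, .all hx h hb hxy hn⟩

theorem all_mem_label_of_all (hnon : ¬ ∃ T', T.NonGen H T') (hx : x ∈ T.nodes)
    (hb : ¬ T.IndirectlyBlocked x) (h : .all S C ∈ T.label x) (hR : H.Trans R) (hRS : H.Sub R S)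
    (hxy : T.RNbr H R x y) : .all R C ∈ T.label y := by
  by_contra hn
  exact hnon ⟨_, .allPlus hx h hb hR hRS hxy hn⟩

theorem mem_label_or_compl_mem_label_of_isBox (hnon : ¬ ∃ T', T.NonGen H T') (hx : x ∈ T.nodes)
    (hb : ¬ T.IndirectlyBlocked x) (hF : Concept.IsBox R C F) (h : F ∈ T.label x)
    (hxy : T.RNbr H R x y) : C ∈ T.label y ∨ C.compl ∈ T.label y := by
  by_contra! hn
  exact hnon ⟨_, .choose hx hF h hb hxy hn.1 hn.2 (.inl rfl)⟩

theorem exists_rNbr_of_ex {ban : CTree NC NR → Node → ℕ} (hgen : ¬ ∃ T', T.Gen H ban T')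
    (hx : x ∈ T.nodes) (hb : ¬ T.Blocked x) (h : .ex R C ∈ T.label x) :
    ∃ y, T.RNbr H R x y ∧ C ∈ T.label y := by
  obtain ⟨y, hxy, hy⟩ := T.exists_isSucc_notMem_nodes x
  by_contra hn
  exact hgen ⟨_, .ex hx h hb hn hxy hy⟩

theorem le_numNbrWith_of_atLeast {ban : CTree NC NR → Node → ℕ} (hgen : ¬ ∃ T', T.Gen H ban T')
    (hx : x ∈ T.nodes) (hb : ¬ T.Blocked x) {n : ℕ} (h : .atLeast n R C ∈ T.label x) :
    n ≤ T.numNbrWith H R x C := by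
  obtain ⟨y, hxy, hy⟩ := T.exists_isSucc_notMem_nodes x
  by_contra! hn
  exact hgen ⟨_, .atLeast hx h hb hn hxy hy⟩

namespace ClashFree

theorem neg_notMem_label (hT : T.ClashFree H) (hx : x ∈ T.nodes) (h : C ∈ T.label x) :
    .neg C ∉ T.label x :=
  fun hn => hT.1 ⟨x, hx, C, h, hn⟩

theorem numNbrWith_le (hT : T.ClashFree H) (hx : x ∈ T.nodes) {n : ℕ}
    (h : .atMost n R C ∈ T.label x) : T.numNbrWith H R x C ≤ n := by
  by_contra! hn
  exact hT.2.1 ⟨x, hx, n, R, C, h, hn⟩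

theorem lt_numNbrWith (hT : T.ClashFree H) (hx : x ∈ T.nodes) {r : ℚ}
    (h : .more r R C ∈ T.label x) : r * T.numNbr H R x < T.numNbrWith H R x C := by
  by_contra! hn
  exact hT.2.2.1 ⟨x, hx, r, R, C, h, hn⟩

theorem numNbrWith_compl_le (hT : T.ClashFree H) (hx : x ∈ T.nodes) {r : ℚ}
    (h : .weak r R C ∈ T.label x) : T.numNbrWith H R x C.compl ≤ r * T.numNbr H R x := by
  by_contra! hn
  exact hT.2.2.2 ⟨x, hx, r, R, C, h, hn⟩

end ClashFree

/-! ### Representatives of blocked nodes -/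

open Classical in
/-- The node standing for `x` in the unravelling: a node blocking `x` if `x` is directly blocked,
and `x` itself otherwise. -/
noncomputable def rep (T : CTree NC NR) (x : Node) : Node :=
  if h : T.DirectlyBlocked x then h.choose else x

theorem DirectlyBlocked.blocks_rep (h : T.DirectlyBlocked x) : T.Blocks (T.rep x) x := by
  rw [rep, dif_pos h]
  exact h.choose_spec

theorem rep_eq_self (h : ¬ T.DirectlyBlocked x) : T.rep x = x :=
  dif_neg h

theorem rep_suffix (T : CTree NC NR) (x : Node) : T.rep x <:+ x := by
  by_cases h : T.DirectlyBlocked x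
  · obtain ⟨-, _, _, -, hanc, -⟩ := h.blocks_rep
    exact hanc.1
  · rw [rep_eq_self h]

theorem label_rep (T : CTree NC NR) (x : Node) : T.label (T.rep x) = T.label x := by
  by_cases h : T.DirectlyBlocked x
  · obtain ⟨-, _, _, -, -, -, -, -, hlabel, -⟩ := h.blocks_rep
    exact hlabel.symm
  · rw [rep_eq_self h]

theorem exists_isSucc_rep (T : CTree NC NR) (h : IsSucc x y) :
    ∃ u, IsSucc u (T.rep y) ∧ T.label u = T.label x ∧ T.edge (T.rep y) = T.edge y := by
  by_cases hy : T.DirectlyBlocked y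
  · obtain ⟨-, x', u, -, -, -, hx', hu, -, hlabel, hedge⟩ := hy.blocks_rep
    obtain rfl : x' = x := hx'.tail_eq.symm.trans h.tail_eq
    exact ⟨u, hu, hlabel.symm, hedge.symm⟩
  · rw [rep_eq_self hy]
    exact ⟨x, h, rfl, rfl⟩

theorem not_blocked_rep (hx : ¬ T.IndirectlyBlocked x) : ¬ T.Blocked (T.rep x) := by
  by_cases h : T.DirectlyBlocked x
  · obtain ⟨hanc, _, _, -, hrep, -⟩ := h.blocks_rep
    exact hanc _ hrep
  · rw [rep_eq_self h, blocked_iff]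
    exact not_or.mpr ⟨h, hx⟩

/-! ### The unravelling -/

/-- The paths through `T` that continue at the blocking node whenever they reach a directly blocked
node. A path is the list of its nodes, the last node coming first. -/
inductive IsPath (T : CTree NC NR) : List Node → Prop
  | root : IsPath T [[]]
  | snoc {x y : Node} {p : List Node} : IsPath T (x :: p) → IsSucc (T.rep x) y → y ∈ T.nodes →
      T.edge y ≠ ∅ → IsPath T (y :: x :: p)

theorem IsPath.ne_nil {p : List Node} (hp : T.IsPath p) : p ≠ [] := by
  cases hp <;> exact List.cons_ne_nil _ _

theorem IsPath.head_mem {p : List Node} (hp : T.IsPath p) (hT : T.IsTree) :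
    p.head hp.ne_nil ∈ T.nodes := by
  cases hp with
  | root => exact hT.root_mem
  | snoc _ _ hy _ => exact hy

theorem IsPath.not_indirectlyBlocked_head {p : List Node} (hp : T.IsPath p) :
    ¬ T.IndirectlyBlocked (p.head hp.ne_nil) := by
  induction hp with
  | root => exact id
  | snoc _ hxy _ hy ih =>
    obtain ⟨k, rfl⟩ := hxy
    exact not_or.mpr ⟨not_blocked_rep ih, hy⟩

/-- The elements of the unravelling of `T`. -/
abbrev Path (T : CTree NC NR) : Type := {p : List Node // T.IsPath p}

namespace Path

variable {s t : T.Path}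

/-- The node of `T` at which a path ends. -/
def last (s : T.Path) : Node := s.1.head s.2.ne_nil

/-- The label of a path in the unravelling, namely that of its last node. -/
def label (s : T.Path) : Set (Concept NC NR) := T.label s.last

/-- The unblocked node of `T` whose neighbours the neighbours of `s` copy. -/
noncomputable def node (s : T.Path) : Node := T.rep s.last

/-- `s` is the path `t` without its last node. -/
def IsParent (s t : T.Path) : Prop := t.1.tail = s.1

/-- `t` is an `R`-successor of `s` in the unravelling. -/
def RSucc (H : RBox NR) (R : Role NR) (s t : T.Path) : Prop :=
  s.IsParent t ∧ ∃ S ∈ T.edge t.last, H.Sub S R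

/-- `t` is an `R`-neighbour of `s` in the unravelling. -/
def RNbr (H : RBox NR) (R : Role NR) (s t : T.Path) : Prop :=
  RSucc H R s t ∨ RSucc H R.inv t s

theorem rNbr_inv_iff : RNbr H R.inv t s ↔ RNbr H R s t := by
  rw [RNbr, RNbr, Role.inv_inv, or_comm]

theorem RSucc.mono (h : RSucc H R s t) (hRS : H.Sub R S) : RSucc H S s t :=
  let ⟨hst, Q, hQ, hQR⟩ := h
  ⟨hst, Q, hQ, hQR.trans hRS⟩

theorem RNbr.mono (h : RNbr H R s t) (hRS : H.Sub R S) : RNbr H S s t :=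
  h.imp (·.mono hRS) (·.mono hRS.inv)

theorem label_node (s : T.Path) : T.label s.node = s.label :=
  T.label_rep s.last

theorem node_mem (hT : T.IsTree) (s : T.Path) : s.node ∈ T.nodes :=
  hT.mem_of_suffix (T.rep_suffix s.last) (s.2.head_mem hT)

theorem not_blocked_node (s : T.Path) : ¬ T.Blocked s.node :=
  not_blocked_rep s.2.not_indirectlyBlocked_head

theorem not_indirectlyBlocked_node (s : T.Path) : ¬ T.IndirectlyBlocked s.node :=
  fun h => s.not_blocked_node ((T.blocked_iff s.node).mpr (.inr h))

theorem IsParent.eq_cons (h : s.IsParent t) : t.1 = t.last :: s.1 :=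
  h ▸ (List.cons_head_tail t.2.ne_nil).symm

theorem IsParent.not_isParent (h : s.IsParent t) : ¬ t.IsParent s := by
  intro h'
  have hst := congrArg List.length h.eq_cons
  have hts := congrArg List.length h'.eq_cons
  simp only [List.length_cons] at hst hts
  omega

theorem IsParent.isSucc_node_last (h : s.IsParent t) : IsSucc s.node t.last := by
  obtain ⟨s, hs⟩ := s
  obtain ⟨_, ht⟩ := t
  obtain rfl := h
  cases ht with
  | root => exact (hs.ne_nil rfl).elim
  | snoc _ hxy _ _ => exact hxy

theorem IsParent.exists_isSucc_node (h : s.IsParent t) :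
    ∃ u, IsSucc u t.node ∧ T.label u = s.label ∧ T.edge t.node = T.edge t.last := by
  obtain ⟨u, hu, hlabel, hedge⟩ := T.exists_isSucc_rep h.isSucc_node_last
  exact ⟨u, hu, hlabel.trans s.label_node, hedge⟩

theorem exists_isParent_last_eq (s : T.Path) (hxy : IsSucc s.node y) (hy : y ∈ T.nodes)
    (he : T.edge y ≠ ∅) : ∃ t : T.Path, s.IsParent t ∧ t.last = y := by
  obtain ⟨_ | ⟨x, p⟩, hs⟩ := s
  · exact (hs.ne_nil rfl).elim
  · exact ⟨⟨y :: x :: p, hs.snoc hxy hy he⟩, rfl, rfl⟩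

theorem exists_isParent_of_isSucc_node (t : T.Path) (h : IsSucc x t.node) :
    ∃ s : T.Path, s.IsParent t := by
  obtain ⟨_, ht⟩ := t
  cases ht with
  | root =>
    have hnil : T.rep [] = [] := List.suffix_nil.mp (T.rep_suffix [])
    exact (not_isSucc_nil x (hnil ▸ h)).elim
  | snoc hp _ _ _ => exact ⟨⟨_, hp⟩, rfl⟩

/-! ### Neighbours in the unravelling and in the tree -/

open Classical in
/-- The neighbour of `s.node` in `T` corresponding to the neighbour `t` of `s`: the last node of `t`
if `t` extends `s`, and otherwise the predecessor of `s.node`. -/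
noncomputable def nbr (s t : T.Path) : Node :=
  if s.IsParent t then t.last else s.node.tail

theorem IsParent.nbr_eq_last (h : s.IsParent t) : nbr s t = t.last :=
  if_pos h

theorem IsParent.nbr_eq_tail (h : t.IsParent s) : nbr s t = s.node.tail :=
  if_neg h.not_isParent

theorem RNbr.label_nbr (h : RNbr H R s t) : T.label (nbr s t) = t.label := by
  rcases h with ⟨h, -⟩ | ⟨h, -⟩
  · rw [h.nbr_eq_last, label]
  · obtain ⟨u, hu, hlabel, -⟩ := h.exists_isSucc_node
    rw [h.nbr_eq_tail, hu.tail_eq, hlabel]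

theorem RNbr.rNbr_nbr (hT : T.IsTree) (h : RNbr H R s t) : T.RNbr H R s.node (nbr s t) := by
  rcases h with ⟨h, hR⟩ | ⟨h, hR⟩
  · rw [h.nbr_eq_last]
    exact .inl ⟨s.node_mem hT, t.2.head_mem hT, h.isSucc_node_last, hR⟩
  · obtain ⟨u, hu, -, hedge⟩ := h.exists_isSucc_node
    rw [h.nbr_eq_tail, hu.tail_eq]
    exact .inr ⟨hT.mem_of_suffix hu.suffix (s.node_mem hT), s.node_mem hT, hu, hedge ▸ hR⟩

theorem IsParent.nbr_ne_nbr {t' : T.Path} (h : s.IsParent t) (h' : t'.IsParent s) :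
    nbr s t ≠ nbr s t' := by
  obtain ⟨k, hk⟩ := h.isSucc_node_last
  rw [h.nbr_eq_last, h'.nbr_eq_tail, hk]
  intro heq
  have := congrArg List.length heq
  simp only [List.length_cons, List.length_tail] at this
  omega

theorem injOn_nbr (H : RBox NR) (R : Role NR) (s : T.Path) :
    Set.InjOn (nbr s) {t | RNbr H R s t} := by
  rintro t (⟨h, -⟩ | ⟨h, -⟩) t' (⟨h', -⟩ | ⟨h', -⟩) heq
  · rw [h.nbr_eq_last, h'.nbr_eq_last] at heq
    exact Subtype.ext (by rw [h.eq_cons, h'.eq_cons, heq])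
  · exact (h.nbr_ne_nbr h' heq).elim
  · exact (h'.nbr_ne_nbr h heq.symm).elim
  · exact Subtype.ext (h.symm.trans h')

theorem exists_rNbr_of_rNbr_node (h : T.RNbr H R s.node y) : ∃ t, RNbr H R s t ∧ nbr s t = y := by
  rcases h with ⟨-, hy, hsy, hR⟩ | ⟨-, -, hys, hR⟩
  · have he : T.edge y ≠ ∅ := Set.nonempty_iff_ne_empty.mp (hR.imp fun _ => And.left)
    obtain ⟨t, hst, rfl⟩ := s.exists_isParent_last_eq hsy hy he
    exact ⟨t, .inl ⟨hst, hR⟩, hst.nbr_eq_last⟩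
  · obtain ⟨t, hts⟩ := s.exists_isParent_of_isSucc_node hys
    obtain ⟨-, -, -, hedge⟩ := hts.exists_isSucc_node
    exact ⟨t, .inr ⟨hts, hedge ▸ hR⟩, hts.nbr_eq_tail.trans hys.tail_eq⟩

theorem bijOn_nbr (hT : T.IsTree) (H : RBox NR) (R : Role NR) (s : T.Path) :
    Set.BijOn (nbr s) {t | RNbr H R s t} {y | T.RNbr H R s.node y} :=
  ⟨fun _ h => h.rNbr_nbr hT, injOn_nbr H R s, fun _ => exists_rNbr_of_rNbr_node⟩

theorem bijOn_nbr_with (hT : T.IsTree) (H : RBox NR) (R : Role NR) (s : T.Path)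
    (C : Concept NC NR) :
    Set.BijOn (nbr s) {t | RNbr H R s t ∧ C ∈ t.label}
      {y | T.RNbr H R s.node y ∧ C ∈ T.label y} := by
  refine ⟨fun t ⟨h, hC⟩ => ⟨h.rNbr_nbr hT, h.label_nbr ▸ hC⟩,
    (injOn_nbr H R s).mono fun _ h => h.1, ?_⟩
  rintro y ⟨hy, hC⟩
  obtain ⟨t, h, rfl⟩ := exists_rNbr_of_rNbr_node hy
  exact ⟨t, ⟨h, h.label_nbr ▸ hC⟩, rfl⟩

theorem ncard_rNbr (hT : T.IsTree) (H : RBox NR) (R : Role NR) (s : T.Path) :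
    {t | RNbr H R s t}.ncard = T.numNbr H R s.node :=
  (bijOn_nbr hT H R s).ncard_eq

theorem ncard_rNbr_with (hT : T.IsTree) (H : RBox NR) (R : Role NR) (s : T.Path)
    (C : Concept NC NR) :
    {t | RNbr H R s t ∧ C ∈ t.label}.ncard = T.numNbrWith H R s.node C :=
  (bijOn_nbr_with hT H R s C).ncard_eq

theorem finite_rNbr (hT : T.IsTree) (H : RBox NR) (R : Role NR) (s : T.Path) :
    {t | RNbr H R s t}.Finite := by
  refine (bijOn_nbr hT H R s).finite_iff_finite.mpr (T.nodes.finite_toSet.subset ?_)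
  rintro y (⟨-, hy, -⟩ | ⟨hy, -⟩) <;> exact hy

end Path

theorem IsCompletionTree.isTableau_unravelling {ban : CTree NC NR → Node → ℕ}
    (hT : T.IsCompletionTree H D) (hnon : ¬ ∃ T', T.NonGen H T') (hgen : ¬ ∃ T', T.Gen H ban T')
    (hcf : T.ClashFree H) : IsTableau H D T.Path Path.label (Path.RNbr H) := by
  have hmem (s : T.Path) := s.node_mem hT.toIsTree
  have hind (s : T.Path) := s.not_indirectlyBlocked_node
  have hlab {s : T.Path} {C} (h : C ∈ s.label) : C ∈ T.label s.node := s.label_node ▸ h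
  have hnbr {R} {s t : T.Path} (h : Path.RNbr H R s t) := h.rNbr_nbr hT.toIsTree
  have hcount (s : T.Path) (R C) := s.ncard_rNbr_with hT.toIsTree H R C
  exact
    { label_subset := fun s => hT.label_subset s.last
      root := ⟨⟨[[]], .root⟩, hT.root_label⟩
      finite := fun s R _ => s.finite_rNbr hT.toIsTree H R
      p1 := fun s _ h hn => hcf.neg_notMem_label (hmem s) (hlab h) (hlab hn)
      p2 := fun s _ _ h => s.label_node ▸ mem_label_of_and hnon (hmem s) (hind s) (hlab h)
      p3 := fun s _ _ h => s.label_node ▸ mem_label_of_or hnon (hmem s) (hind s) (hlab h)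
      p4 := fun s _ _ _ _ h hst =>
        hst.label_nbr ▸ mem_label_of_all hnon (hmem s) (hind s) (hlab h) (hnbr hst)
      p5 := fun s _ _ _ h => by
        obtain ⟨y, hy, hC⟩ := exists_rNbr_of_ex hgen (hmem s) s.not_blocked_node (hlab h)
        obtain ⟨t, hst, rfl⟩ := Path.exists_rNbr_of_rNbr_node hy
        exact ⟨t, hst, hst.label_nbr ▸ hC⟩
      p6 := fun s _ _ _ _ _ _ h hst hRS hR =>
        hst.label_nbr ▸ all_mem_label_of_all hnon (hmem s) (hind s) (hlab h) hR hRS (hnbr hst)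
      p7 := fun _ _ _ _ => Path.rNbr_inv_iff.symm
      p8 := fun _ _ _ _ _ _ h hRS => h.mono hRS
      p9 := fun s C _ R _ h => hcount s R C ▸ hcf.numNbrWith_le (hmem s) (hlab h)
      p10 := fun s C _ R _ h =>
        hcount s R C ▸ le_numNbrWith_of_atLeast hgen (hmem s) s.not_blocked_node (hlab h)
      p11 := fun s _ _ _ _ h => by
        rw [hcount, s.ncard_rNbr hT.toIsTree]
        exact hcf.lt_numNbrWith (hmem s) (hlab h)
      p12 := fun s _ _ _ _ h => by
        rw [hcount, s.ncard_rNbr hT.toIsTree]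
        exact hcf.numNbrWith_compl_le (hmem s) (hlab h)
      p13 := fun s _ _ _ _ _ hF h hst => hst.label_nbr ▸
        mem_label_or_compl_mem_label_of_isBox hnon (hmem s) (hind s) hF (hlab h) (hnbr hst) }

end CTree

end ALCQPIH

theorem mainTheorem5_general {NC NR : Type*} (H : ALCQPIH.RBox NR)
    (ban : ALCQPIH.CTree NC NR → ALCQPIH.Node → ℕ) (D : ALCQPIH.Concept NC NR)
    (h : ∃ T : ALCQPIH.CTree NC NR,
      ALCQPIH.CTree.Yields H ban D T ∧ T.Complete H ban ∧ T.ClashFree H) :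
    ALCQPIH.HasTableau H D := by
  obtain ⟨T, hyields, ⟨hnon, hgen⟩ | hclash | hclash, hcf⟩ := h
  · exact ⟨T.Path, _, _, hyields.isCompletionTree.isTableau_unravelling hnon hgen hcf⟩
  · exact (hcf.1 hclash).elim
  · exact (hcf.2.1 hclash).elim

theorem mainTheorem5 {NC NR : Type*} [Nonempty NC] [Nonempty NR]
    (H : ALCQPIH.RBox NR) (Q₀ : Set ℚ) (hQ₀ : Q₀ ⊆ Set.Ioo 0 1)
    (ban : ALCQPIH.CTree NC NR → ALCQPIH.Node → ℕ)
    (D : ALCQPIH.Concept NC NR) (hD : D.IsConcept H Q₀) (hnnf : D.IsNNF)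
    (h : ∃ T : ALCQPIH.CTree NC NR,
      ALCQPIH.CTree.Yields H ban D T ∧ T.Complete H ban ∧ T.ClashFree H) :
    ALCQPIH.HasTableau H D :=
  mainTheorem5_general H ban D h
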